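/- Let $D,m,L_s\ge 1$ be integers with $3\mid m$, let $\eta>0$, let $\mathbf A\in\mathbb R^{D\times D}$ be symmetric positive semidefinite, and let $\widetilde{\mathbf A}\in\mathbb R^{D\times D}$ be any matrix. Let $S,G\in\mathbb R^{D\times (m/3)}$ be independent random matrices with i.i.d. standard Gaussian entries. Let $Q=\mathrm{QR}(\mathbf A S)$, that is, $Q$ is a matrix whose columns form an orthonormal basis of the column space of $\mathbf A S$. The approximate Hutch++ estimator of $\mathrm{Tr}(\widetilde{\mathbf A})$ is $$\widetilde H_m^{++}(\widetilde{\mathbf A}) := \mathrm{Tr}(Q^\top\widetilde{\mathbf A}Q)+H_{m/3}\big((I-QQ^\top)\widetilde{\mathbf A}(I-QQ^\top)\big),\qquad H_{n}(\mathbf B):=\frac1n\sum_{i=1}^{n}\mathbf g_i^\top \mathbf B\,\mathbf g_i,$$ where $\mathbf g_1,\dots,\mathbf g_{m/3}$ are the columns of $G$. Then the estimator is square integrable and $$\mathbb E\big[\widetilde H_m^{++}(\widetilde{\mathbf A})\big]=\mathrm{Tr}(\widetilde{\mathbf A}).$$ Suppose moreover that $m>3$ and that $\widetilde{\mathbf A}$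 is an $\mathcal O((L_s-1)\eta)$ perturbation of $\mathbf A$, in the sense that $\|\widetilde{\mathbf A}-\mathbf A\|_F\le c\,(L_s-1)\eta$ with a constant $c$, where $\|\cdot\|_F$ is the Frobenius norm. Then $$\mathrm{Var}\big(\widetilde H_m^{++}(\widetilde{\mathbf A})\big)\le\frac{36}{m(m-3)}\,\mathrm{Tr}^2(\mathbf A)+\frac1m\,K\,(L_s-1)^2\eta^2,$$ where the constant $K$ depends only on $c$. -/

import Mathlib

open MeasureTheory ProbabilityTheory

open scoped Matrix

-- `‖M‖` is the Frobenius norm of a matrix `M`.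
attribute [local instance] Matrix.frobeniusNormedAddCommGroup

/-- `Q` is what a QR decomposition of `M` returns: a matrix whose columns are an orthonormal basis
of the column space of `M`. (If `M` has dependent columns, `Q` has fewer columns than `M`.) -/
structure IsQRBasis {D n r : ℕ} (M : Matrix (Fin D) (Fin n) ℝ) (Q : Matrix (Fin D) (Fin r) ℝ) :
    Prop where
  orthonormal : Qᵀ * Q = 1
  range_eq : LinearMap.range Q.mulVecLin = LinearMap.range M.mulVecLin

/-- The Hutchinson estimator `(1 / n) ∑ⱼ vⱼᵀ B vⱼ`, where `v₁, …, vₙ` are the columns of `V`. -/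
noncomputable def hutchinson {D n : ℕ} (B : Matrix (Fin D) (Fin D) ℝ)
    (V : Matrix (Fin D) (Fin n) ℝ) : ℝ :=
  1 / (n : ℝ) * ∑ j, (V.col j ⬝ᵥ (B *ᵥ V.col j))

/-- The approximate Hutch++ estimator
`Tr (Qᵀ B Q) + H ((I - Q Qᵀ) B (I - Q Qᵀ))` of the trace of `B`, where `Q` may come from a matrix
other than `B` and `H` is the Hutchinson estimator with the columns of `G` as probe vectors. -/
noncomputable def approxHutchPP {D n r : ℕ} (B : Matrix (Fin D) (Fin D) ℝ)
    (Q : Matrix (Fin D) (Fin r) ℝ) (G : Matrix (Fin D) (Fin n) ℝ) : ℝ :=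
  (Qᵀ * B * Q).trace + hutchinson ((1 - Q * Qᵀ) * B * (1 - Q * Qᵀ)) G

/-- `S` and `G` are independent random matrices with independent standard Gaussian entries. -/
structure IsGaussianSketchAndProbes {Ω : Type*} [MeasurableSpace Ω] (P : Measure Ω) {D n : ℕ}
    (S G : Ω → Matrix (Fin D) (Fin n) ℝ) : Prop where
  law_sketch : ∀ i j, HasLaw (fun ω => S ω i j) (gaussianReal 0 1) P
  law_probe : ∀ i j, HasLaw (fun ω => G ω i j) (gaussianReal 0 1) P
  indep : iIndepFun
    (Sum.elim (fun (p : Fin D × Fin n) ω => S ω p.1 p.2) (fun (p : Fin D × Fin n) ω => G ω p.1 p.2))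
    P

/-! Let `L = 1 - Q Qᵀ`. By cyclicity of the trace, the estimator equals `Tr A'` plus the centred
Hutchinson error of `B = L A' L`. The projection `L` depends only on the column space of `A S`, so
`complProj` writes it as an explicit measurable function of the sketch and no measurability of `Q`
is needed. Given the sketch, the error is a centred Gaussian quadratic form: its mean is `0` and its
second moment is at most `2 ‖B‖² / n` (Frobenius norm, `n` probes). This already gives unbiasedness
and square integrability, since `‖B‖ ≤ ‖A'‖`.

For the variance, `L` kills the columns of `A S`, hence `L A = L N`, where `N` is the Nyström
residual of `A` (`mul_residual`). So `‖B‖² ≤ 2 ‖N‖² + 2 ‖A' - A‖²`, and what remains is `E ‖N‖² ≤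
(Tr A)² / (n - 1)`, which is `lintegral_residual_le`.

That bound is proved by deflating one Gaussian column at a time. A step on `R` with trace `t` and
squared norm `f` lowers the trace by `X = ‖R s‖² / ⟨s, R s⟩`, where `0 ≤ X ≤ √f` and `E X ≥ (2/π) f
/ t`. If `f` is already below the target, nothing is to be done because deflation never increases
the norm; otherwise `f` is large relative to `t²`, the trace drops substantially, and induction
applies to the deflated matrix. -/

namespace Matrix

/-! ### Frobenius norm estimates -/

/-- The sum of the squares of the entries of a matrix, i.e. the squared Frobenius norm. -/
def entrySq {m n : Type*} [Fintype m] [Fintype n] (M : Matrix m n ℝ) : ℝ := ∑ i, ∑ j, M i j ^ 2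

lemma entrySq_nonneg {m n : Type*} [Fintype m] [Fintype n] (M : Matrix m n ℝ) : 0 ≤ M.entrySq :=
  Finset.sum_nonneg fun _ _ => Finset.sum_nonneg fun _ _ => sq_nonneg _

lemma entrySq_eq_trace {m n : Type*} [Fintype m] [Fintype n] (M : Matrix m n ℝ) :
    M.entrySq = (M * Mᵀ).trace := by
  simp [entrySq, trace, mul_apply, sq]

lemma entrySq_transpose {m n : Type*} [Fintype m] [Fintype n] (M : Matrix m n ℝ) :
    Mᵀ.entrySq = M.entrySq := by
  simp only [entrySq, transpose_apply]
  exact Finset.sum_comm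

lemma entrySq_eq_norm_sq {m n : Type*} [Fintype m] [Fintype n] (M : Matrix m n ℝ) :
    M.entrySq = ‖M‖ ^ 2 := by
  have h : (0 : ℝ) ≤ ∑ i, ∑ j, ‖M i j‖ ^ (2 : ℝ) := by positivity
  rw [frobenius_norm_def, ← Real.rpow_natCast, ← Real.rpow_mul h]
  norm_num [entrySq]

lemma entrySq_add_le {m n : Type*} [Fintype m] [Fintype n] (M N : Matrix m n ℝ) :
    (M + N).entrySq ≤ 2 * M.entrySq + 2 * N.entrySq := by
  simp only [entrySq, Finset.mul_sum, ← Finset.sum_add_distrib]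
  refine Finset.sum_le_sum fun i _ => Finset.sum_le_sum fun j _ => ?_
  simp only [add_apply]
  nlinarith [sq_nonneg (M i j - N i j)]

/-- The difference of the two sides is half the squared norm of `M - Mᵀ`. -/
lemma trace_sq_le_entrySq {m : Type*} [Fintype m] (M : Matrix m m ℝ) :
    (M * M).trace ≤ M.entrySq := by
  have h : 0 ≤ ∑ i, ∑ j, (M i j - M j i) ^ 2 := by positivity
  have h2 : ∑ i, ∑ j, (M i j - M j i) ^ 2 = 2 * M.entrySq - 2 * (M * M).trace := by
    have h3 : ∑ i, ∑ j, M j i ^ 2 = M.entrySq := Finset.sum_comm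
    have h4 : (M * M).trace = ∑ i, ∑ j, M i j * M j i := by simp [trace, mul_apply]
    have h5 : ∑ i, ∑ j, (M i j - M j i) ^ 2
        = M.entrySq + ∑ i, ∑ j, M j i ^ 2 - 2 * ∑ i, ∑ j, M i j * M j i := by
      simp only [entrySq, Finset.mul_sum, ← Finset.sum_add_distrib, ← Finset.sum_sub_distrib]
      exact Finset.sum_congr rfl fun i _ => Finset.sum_congr rfl fun j _ => by ring
    rw [h5, h3, h4]; ring
  linarith

lemma dotProduct_mulVec_sq_le {m : Type*} [Fintype m] (M : Matrix m m ℝ) (v : m → ℝ) :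
    (v ⬝ᵥ M *ᵥ v) ^ 2 ≤ M.entrySq * (v ⬝ᵥ v) ^ 2 := by
  have h := Finset.sum_mul_sq_le_sq_mul_sq (Finset.univ : Finset (m × m)) (fun p => M p.1 p.2)
    (fun p => v p.1 * v p.2)
  simp only [Fintype.sum_prod_type] at h
  have e1 : v ⬝ᵥ M *ᵥ v = ∑ i, ∑ j, M i j * (v i * v j) := by
    simp only [dotProduct, mulVec, Finset.mul_sum]
    exact Finset.sum_congr rfl fun i _ => Finset.sum_congr rfl fun j _ => by ring
  have e2 : (v ⬝ᵥ v) ^ 2 = ∑ i, ∑ j, (v i * v j) ^ 2 := by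
    simp only [sq, dotProduct, Finset.sum_mul_sum]
    exact Finset.sum_congr rfl fun i _ => Finset.sum_congr rfl fun j _ => by ring
  rwa [e1, e2]

lemma abs_dotProduct_mulVec_le {m : Type*} [Fintype m] (M : Matrix m m ℝ) (v : m → ℝ) :
    |v ⬝ᵥ M *ᵥ v| ≤ √M.entrySq * (v ⬝ᵥ v) := by
  have h0 : 0 ≤ v ⬝ᵥ v := by simpa using dotProduct_star_self_nonneg v
  refine abs_le_of_sq_le_sq ?_ (by positivity)
  rw [mul_pow, Real.sq_sqrt M.entrySq_nonneg]
  exact M.dotProduct_mulVec_sq_le v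

/-- Multiplication by an orthogonal projection does not increase the Frobenius norm. -/
lemma entrySq_mul_le {m n : Type*} [Fintype m] [Fintype n] {L : Matrix m m ℝ} (hs : Lᵀ = L)
    (hi : L * L = L) (M : Matrix m n ℝ) : (L * M).entrySq ≤ M.entrySq := by
  classical
  have key : M.entrySq = (L * M).entrySq + ((1 - L) * M).entrySq := by
    have h : ∀ N : Matrix m n ℝ, N.entrySq = (Nᵀ * N).trace := fun N => by
      rw [entrySq_eq_trace, trace_mul_comm]
    have hi' : (1 - L) * (1 - L) = 1 - L := by
      simp [Matrix.mul_sub, Matrix.sub_mul, hi]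
    have hs' : (1 - L)ᵀ = 1 - L := by rw [transpose_sub, hs, transpose_one]
    simp only [h, transpose_mul, hs, hs']
    rw [Matrix.mul_assoc, ← Matrix.mul_assoc L, hi, Matrix.mul_assoc, ← Matrix.mul_assoc (1 - L),
      hi', ← trace_add, ← Matrix.mul_add, ← Matrix.add_mul, add_sub_cancel, Matrix.one_mul]
  linarith [((1 - L) * M).entrySq_nonneg]

lemma entrySq_mul_mul_le {m : Type*} [Fintype m] {L : Matrix m m ℝ} (hs : Lᵀ = L)
    (hi : L * L = L) (M : Matrix m m ℝ) : (L * M * L).entrySq ≤ M.entrySq := by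
  rw [Matrix.mul_assoc]
  refine (entrySq_mul_le hs hi _).trans ?_
  rw [← entrySq_transpose, transpose_mul, hs]
  exact (entrySq_mul_le hs hi _).trans (entrySq_transpose M).le

/-! ### Cauchy–Schwarz for positive semidefinite forms -/

section PosSemidef

lemma PosSemidef.transpose_eq {m : Type*} {R : Matrix m m ℝ} (hR : R.PosSemidef) : Rᵀ = R := by
  simpa using hR.isHermitian.eq

variable {m : Type*} [Fintype m] {R : Matrix m m ℝ}

lemma PosSemidef.dotProduct_mulVec_comm (hR : R.PosSemidef) (x y : m → ℝ) :
    x ⬝ᵥ R *ᵥ y = R *ᵥ x ⬝ᵥ y := by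
  rw [dotProduct_mulVec, ← mulVec_transpose, hR.transpose_eq]

lemma PosSemidef.quad_nonneg (hR : R.PosSemidef) (x : m → ℝ) : 0 ≤ x ⬝ᵥ R *ᵥ x := by
  simpa using hR.dotProduct_mulVec_nonneg x

lemma PosSemidef.cauchySchwarz (hR : R.PosSemidef) (x y : m → ℝ) :
    (x ⬝ᵥ R *ᵥ y) ^ 2 ≤ (x ⬝ᵥ R *ᵥ x) * (y ⬝ᵥ R *ᵥ y) := by
  have h : ∀ a : ℝ, 0 ≤ (y ⬝ᵥ R *ᵥ y) * (a * a) + (2 * (x ⬝ᵥ R *ᵥ y)) * a + x ⬝ᵥ R *ᵥ x := by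
    intro a
    have := hR.quad_nonneg (x + a • y)
    have hc : y ⬝ᵥ R *ᵥ x = x ⬝ᵥ R *ᵥ y := by
      rw [hR.dotProduct_mulVec_comm, dotProduct_comm]
    simp only [mulVec_add, mulVec_smul, add_dotProduct, dotProduct_add, smul_dotProduct,
      dotProduct_smul, smul_eq_mul, hc] at this
    linarith
  have := discrim_le_zero h
  rw [discrim] at this
  nlinarith

lemma PosSemidef.mulVec_eq_zero (hR : R.PosSemidef) {x : m → ℝ} (hx : x ⬝ᵥ R *ᵥ x = 0) :
    R *ᵥ x = 0 := by
  have h := hR.cauchySchwarz (R *ᵥ x) x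
  rw [hx, mul_zero] at h
  have h2 : R *ᵥ x ⬝ᵥ R *ᵥ x = 0 := by nlinarith [sq_nonneg (R *ᵥ x ⬝ᵥ R *ᵥ x)]
  exact dotProduct_self_eq_zero.mp h2

lemma PosSemidef.entrySq_le_trace_sq [DecidableEq m] (hR : R.PosSemidef) :
    R.entrySq ≤ R.trace ^ 2 := by
  rw [sq, trace, Finset.sum_mul_sum]
  refine Finset.sum_le_sum fun i _ => Finset.sum_le_sum fun j _ => ?_
  simpa using hR.cauchySchwarz (Pi.single i 1) (Pi.single j 1)

/-- `‖R x‖² ≤ ‖R‖_F ⟨x, R x⟩` for a positive semidefinite matrix `R`. -/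
lemma PosSemidef.dotProduct_self_mulVec_le (hR : R.PosSemidef) (x : m → ℝ) :
    R *ᵥ x ⬝ᵥ R *ᵥ x ≤ √R.entrySq * (x ⬝ᵥ R *ᵥ x) := by
  -- With `y = R x`: `‖y‖⁴ ≤ ⟨y, R y⟩ ⟨x, R x⟩ ≤ ‖R‖ ‖y‖² ⟨x, R x⟩`; then cancel `‖y‖²`.
  have h1 := hR.cauchySchwarz (R *ᵥ x) x
  have h2 := (le_abs_self _).trans (R.abs_dotProduct_mulVec_le (R *ᵥ x))
  have h0 : 0 ≤ R *ᵥ x ⬝ᵥ R *ᵥ x := by simpa using dotProduct_star_self_nonneg (R *ᵥ x)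
  rcases h0.eq_or_lt with h | h
  · rw [← h]; have := hR.quad_nonneg x; positivity
  · have h3 := mul_le_mul_of_nonneg_right h2 (hR.quad_nonneg x)
    by_contra! hc
    nlinarith

end PosSemidef

/-! ### Nyström residuals by successive deflation -/

section Deflate

variable {m : Type*} [Fintype m]

/-- The residual `R - (sᵀ R s)⁻¹ R s sᵀ R` of a one-column Nyström approximation of `R`. -/
noncomputable def deflate (R : Matrix m m ℝ) (s : m → ℝ) : Matrix m m ℝ :=
  R - (s ⬝ᵥ R *ᵥ s)⁻¹ • vecMulVec (R *ᵥ s) (s ᵥ* R)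

lemma deflate_mulVec (R : Matrix m m ℝ) (s v : m → ℝ) :
    R.deflate s *ᵥ v = R *ᵥ v - ((s ⬝ᵥ R *ᵥ s)⁻¹ * (s ⬝ᵥ R *ᵥ v)) • (R *ᵥ s) := by
  rw [deflate, sub_mulVec, smul_mulVec, vecMulVec_mulVec, dotProduct_mulVec s R v]
  ext i; simp [mul_comm, mul_left_comm]

variable {R : Matrix m m ℝ}

lemma PosSemidef.deflate (hR : R.PosSemidef) (s : m → ℝ) : (R.deflate s).PosSemidef := by
  have ht : s ᵥ* R = R *ᵥ s := by rw [← mulVec_transpose, hR.transpose_eq]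
  refine PosSemidef.of_dotProduct_mulVec_nonneg ?_ fun x => ?_
  · rw [IsHermitian, conjTranspose_eq_transpose_of_trivial, Matrix.deflate, transpose_sub,
      transpose_smul, transpose_vecMulVec, hR.transpose_eq, ht]
  · rw [star_trivial, deflate_mulVec, dotProduct_sub, dotProduct_smul, smul_eq_mul]
    have h := hR.cauchySchwarz s x
    have hc : x ⬝ᵥ R *ᵥ s = s ⬝ᵥ R *ᵥ x := by rw [hR.dotProduct_mulVec_comm, dotProduct_comm]
    rw [hc, mul_assoc, ← sq, sub_nonneg]
    -- When `sᵀ R s = 0` the inverse is `0` by convention and deflation leaves `R` unchanged. This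
    -- is the right value, since then `R s = 0`.
    rcases (hR.quad_nonneg s).eq_or_lt with h0 | h0
    · rw [← h0, _root_.inv_zero, zero_mul]; exact hR.quad_nonneg x
    · rwa [inv_mul_le_iff₀ h0]

lemma PosSemidef.trace_deflate (hR : R.PosSemidef) (s : m → ℝ) :
    (R.deflate s).trace = R.trace - (R *ᵥ s ⬝ᵥ R *ᵥ s) / (s ⬝ᵥ R *ᵥ s) := by
  have ht : s ᵥ* R = R *ᵥ s := by rw [← mulVec_transpose, hR.transpose_eq]
  rw [Matrix.deflate, trace_sub, trace_smul, ht, trace_vecMulVec, smul_eq_mul, inv_mul_eq_div]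

/-- With `w = R s` and `d = ⟨s, w⟩`, the square expands to `‖R‖² - 2 d⁻¹ ⟨w, R w⟩ + d⁻² ‖w‖⁴`, and
Cauchy–Schwarz bounds the last term by `d⁻¹ ⟨w, R w⟩`. -/
lemma PosSemidef.entrySq_deflate_le (hR : R.PosSemidef) (s : m → ℝ) :
    (R.deflate s).entrySq ≤ R.entrySq := by
  have ht : s ᵥ* R = R *ᵥ s := by rw [← mulVec_transpose, hR.transpose_eq]
  set d := s ⬝ᵥ R *ᵥ s with hd
  set w := R *ᵥ s with hw
  have h1 : (R.deflate s).entrySq = R.entrySq - 2 * d⁻¹ * (w ⬝ᵥ R *ᵥ w) + (d⁻¹ * (w ⬝ᵥ w)) ^ 2 := by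
    have e1 : w ⬝ᵥ R *ᵥ w = ∑ i, ∑ j, R i j * (w i * w j) := by
      simp only [dotProduct, mulVec, Finset.mul_sum]
      exact Finset.sum_congr rfl fun i _ => Finset.sum_congr rfl fun j _ => by ring
    have e2 : (w ⬝ᵥ w) ^ 2 = ∑ i, ∑ j, (w i * w j) ^ 2 := by
      simp only [sq, dotProduct, Finset.sum_mul_sum]
      exact Finset.sum_congr rfl fun i _ => Finset.sum_congr rfl fun j _ => by ring
    rw [mul_pow, e1, e2]
    simp only [entrySq, Finset.mul_sum, ← Finset.sum_add_distrib, ← Finset.sum_sub_distrib]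
    refine Finset.sum_congr rfl fun i _ => Finset.sum_congr rfl fun j _ => ?_
    rw [Matrix.deflate, ht, sub_apply, smul_apply, vecMulVec_apply, smul_eq_mul]
    ring
  have hcs : (w ⬝ᵥ w) ^ 2 ≤ (w ⬝ᵥ R *ᵥ w) * d := hR.cauchySchwarz w s
  have h0 : 0 ≤ w ⬝ᵥ R *ᵥ w := hR.quad_nonneg w
  rw [h1]
  rcases (hR.quad_nonneg s).eq_or_lt with hd0 | hd0
  · have : d = 0 := hd0.symm
    simp [this]
  · have : (d⁻¹ * (w ⬝ᵥ w)) ^ 2 ≤ d⁻¹ * (w ⬝ᵥ R *ᵥ w) := by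
      rw [mul_pow, inv_pow, inv_mul_le_iff₀ (by positivity)]
      field_simp
      linarith
    have := mul_nonneg (inv_nonneg.mpr hd0.le) h0
    linarith

lemma PosSemidef.deflate_mulVec_self (hR : R.PosSemidef) (s : m → ℝ) : R.deflate s *ᵥ s = 0 := by
  rw [deflate_mulVec]
  by_cases h : s ⬝ᵥ R *ᵥ s = 0
  · simp [hR.mulVec_eq_zero h]
  · simp [inv_mul_cancel₀ h]

lemma deflate_mulVec_eq_zero (s : m → ℝ) {v : m → ℝ} (hv : R *ᵥ v = 0) :
    R.deflate s *ᵥ v = 0 := by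
  simp [deflate_mulVec, hv]

lemma mul_deflate {l : Type*} (L : Matrix l m ℝ) {s : m → ℝ} (h : L *ᵥ (R *ᵥ s) = 0) :
    L * R.deflate s = L * R := by
  rw [deflate, Matrix.mul_sub, Matrix.mul_smul, mul_vecMulVec, h]
  simp

/-- The residual of the Nyström approximation of `R` with sketching vectors `s 0, s 1, …`. -/
noncomputable def residual : {n : ℕ} → Matrix m m ℝ → (Fin n → m → ℝ) → Matrix m m ℝ
  | 0, R, _ => R
  | _ + 1, R, s => residual (R.deflate (s 0)) (Fin.tail s)

lemma PosSemidef.residual {n : ℕ} {R : Matrix m m ℝ} (hR : R.PosSemidef) (s : Fin n → m → ℝ) :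
    (R.residual s).PosSemidef := by
  induction n generalizing R with
  | zero => exact hR
  | succ n ih => exact ih (hR.deflate _) _

lemma PosSemidef.entrySq_residual_le {n : ℕ} {R : Matrix m m ℝ} (hR : R.PosSemidef)
    (s : Fin n → m → ℝ) : (R.residual s).entrySq ≤ R.entrySq := by
  induction n generalizing R with
  | zero => exact le_rfl
  | succ n ih => exact (ih (hR.deflate _) _).trans (hR.entrySq_deflate_le _)

lemma residual_mulVec_eq_zero {n : ℕ} {R : Matrix m m ℝ} (s : Fin n → m → ℝ) {v : m → ℝ}
    (hv : R *ᵥ v = 0) : R.residual s *ᵥ v = 0 := by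
  induction n generalizing R with
  | zero => exact hv
  | succ n ih => exact ih _ (deflate_mulVec_eq_zero _ hv)

/-- Deflating by a vector puts it in the kernel, and later deflations only enlarge the kernel. -/
lemma PosSemidef.residual_mulVec_self {n : ℕ} {R : Matrix m m ℝ} (hR : R.PosSemidef)
    (s : Fin n → m → ℝ) (j : Fin n) : R.residual s *ᵥ s j = 0 := by
  induction n generalizing R with
  | zero => exact j.elim0
  | succ n ih =>
    refine Fin.cases ?_ (fun j => ?_) j
    · exact residual_mulVec_eq_zero (R := R.deflate (s 0)) _ (hR.deflate_mulVec_self _)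
    · exact ih (hR.deflate (s 0)) (Fin.tail s) j

/-- Each deflation subtracts a matrix whose columns are multiples of the current `R s`, and `L`
annihilates that vector at every stage because `L R` never changes. Used both for `R = A` and, with
`R = 1`, to handle the projection itself. -/
lemma mul_residual {l : Type*} {n : ℕ} {R : Matrix m m ℝ} (L : Matrix l m ℝ) (s : Fin n → m → ℝ)
    (h : ∀ j, L *ᵥ (R *ᵥ s j) = 0) : L * R.residual s = L * R := by
  induction n generalizing R with
  | zero => rfl
  | succ n ih =>
    have h0 := mul_deflate L (h 0)
    rw [residual, ih (Fin.tail s) fun j => ?_, h0]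
    rw [mulVec_mulVec, h0, ← mulVec_mulVec]
    exact h j.succ

end Deflate

end Matrix

/-! ### Moments of one Gaussian variable -/

section GaussianMoments

lemma integral_abs_pow_gaussianReal (k : ℕ) :
    ∫ x, |x| ^ k ∂gaussianReal 0 1 = 2 * (√(2 * Real.pi))⁻¹ *
      ((1 / 2 : ℝ) ^ (-((k : ℝ) + 1) / 2) * (1 / 2) * Real.Gamma (((k : ℝ) + 1) / 2)) := by
  rw [integral_gaussianReal_eq_integral_smul one_ne_zero]
  have h : ∀ x : ℝ, gaussianPDFReal 0 1 x • |x| ^ k =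
      (fun y : ℝ => (√(2 * Real.pi))⁻¹ * (y ^ k * Real.exp (-(1 / 2) * y ^ (2 : ℝ)))) |x| := by
    intro x
    simp only [gaussianPDFReal, smul_eq_mul, NNReal.coe_one, mul_one, sub_zero, Real.rpow_two,
      sq_abs]
    rw [show -x ^ 2 / 2 = -(1 / 2) * x ^ 2 by ring]
    ring
  simp_rw [h]
  rw [integral_comp_abs (f := fun y : ℝ =>
    (√(2 * Real.pi))⁻¹ * (y ^ k * Real.exp (-(1 / 2) * y ^ (2 : ℝ)))), integral_const_mul]
  have := integral_rpow_mul_exp_neg_mul_rpow (p := 2) (q := k) (b := 1 / 2) two_pos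
    (by have : (0 : ℝ) ≤ k := k.cast_nonneg
        linarith) (by norm_num)
  simp only [Real.rpow_natCast] at this
  rw [this]
  ring

lemma integral_abs_gaussianReal : ∫ x, |x| ∂gaussianReal 0 1 = √(2 / Real.pi) := by
  have h := integral_abs_pow_gaussianReal 1
  simp only [pow_one] at h
  rw [h]
  have h1 : (1 / 2 : ℝ) ^ (-(((1 : ℕ) : ℝ) + 1) / 2) = 2 := by
    rw [show -(((1 : ℕ) : ℝ) + 1) / 2 = -1 by norm_num, Real.rpow_neg_one]; norm_num
  have h2 : Real.Gamma ((((1 : ℕ) : ℝ) + 1) / 2) = 1 := by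
    rw [show (((1 : ℕ) : ℝ) + 1) / 2 = 1 by norm_num, Real.Gamma_one]
  rw [h1, h2, Real.sqrt_mul zero_le_two, Real.sqrt_div zero_le_two]
  have h3 : √2 * √2 = (2 : ℝ) := Real.mul_self_sqrt zero_le_two
  have : 0 < √Real.pi := Real.sqrt_pos.mpr Real.pi_pos
  field_simp
  linarith

lemma integral_pow_four_gaussianReal : ∫ x, x ^ 4 ∂gaussianReal 0 1 = 3 := by
  have h := integral_abs_pow_gaussianReal 4
  have e : ∀ x : ℝ, |x| ^ 4 = x ^ 4 := fun x => (show Even 4 by decide).pow_abs x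
  simp only [e] at h
  rw [h]
  have h1 : (1 / 2 : ℝ) ^ (-(((4 : ℕ) : ℝ) + 1) / 2) = 4 * √2 := by
    rw [one_div, Real.inv_rpow zero_le_two, ← Real.rpow_neg zero_le_two,
      show -(-(((4 : ℕ) : ℝ) + 1) / 2) = (2 : ℕ) + 1 / 2 by norm_num,
      Real.rpow_add two_pos, Real.rpow_natCast, Real.sqrt_eq_rpow]
    norm_num
  have h2 : Real.Gamma ((((4 : ℕ) : ℝ) + 1) / 2) = 3 / 4 * √Real.pi := by
    rw [show (((4 : ℕ) : ℝ) + 1) / 2 = (1 / 2 + 1) + 1 by norm_num,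
      Real.Gamma_add_one (by norm_num), Real.Gamma_add_one (by norm_num), Real.Gamma_one_half_eq]
    ring
  rw [h1, h2, Real.sqrt_mul zero_le_two]
  have : 0 < √Real.pi := Real.sqrt_pos.mpr Real.pi_pos
  field_simp

lemma integral_pow_odd_gaussianReal {k : ℕ} (hk : Odd k) : ∫ x, x ^ k ∂gaussianReal 0 1 = 0 := by
  have h : ∫ x, x ^ k ∂gaussianReal 0 1 = ∫ x, (-x) ^ k ∂gaussianReal 0 1 := by
    conv_lhs => rw [show gaussianReal 0 1 = (gaussianReal 0 1).map (fun x => -x) by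
      rw [gaussianReal_map_neg, neg_zero]]
    rw [integral_map (by fun_prop) (by fun_prop)]
  simp only [hk.neg_pow, integral_neg] at h
  linarith

lemma integral_sq_gaussianReal : ∫ x, x ^ 2 ∂gaussianReal 0 1 = 1 := by
  have h := variance_fun_id_gaussianReal (μ := 0) (v := 1)
  rw [variance_of_integral_eq_zero (by fun_prop) (by simp)] at h
  simpa using h

lemma integrable_pow_gaussianReal (k : ℕ) : Integrable (fun x => x ^ k) (gaussianReal 0 1) := by
  rcases Nat.eq_zero_or_pos k with rfl | hk
  · simp
  · have := (memLp_id_gaussianReal' (μ := 0) (v := 1) (k : ENNReal)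
      (ENNReal.natCast_ne_top k)).integrable_norm_pow hk.ne'
    refine this.mono (by fun_prop) (Filter.Eventually.of_forall fun x => ?_)
    simp

end GaussianMoments

/-! ### Linear functionals of a Gaussian vector -/

section StdGaussianVector

variable {ι : Type*} [Fintype ι]

/-- The law of a vector of independent standard Gaussian variables. -/
noncomputable abbrev gaussianVector (ι : Type*) [Fintype ι] : Measure (ι → ℝ) :=
  Measure.pi fun _ => gaussianReal 0 1

lemma map_dotProduct_gaussianVector (r : ι → ℝ) :
    (gaussianVector ι).map (fun s => r ⬝ᵥ s) = gaussianReal 0 (r ⬝ᵥ r).toNNReal := by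
  have h := IsGaussian.map_eq_gaussianReal (μ := stdGaussian (EuclideanSpace ℝ ι))
    (innerSL ℝ (WithLp.toLp 2 r))
  rw [integral_strongDual_stdGaussian, variance_dual_stdGaussian, ← map_pi_eq_stdGaussian,
    Measure.map_map (by fun_prop) (by fun_prop)] at h
  convert h using 2
  · ext s
    simp [PiLp.inner_apply, dotProduct, mul_comm]
  · rw [innerSL_apply_norm, EuclideanSpace.real_norm_sq_eq]
    simp [dotProduct, sq]

lemma integral_abs_dotProduct_gaussianVector (r : ι → ℝ) :
    ∫ s, |r ⬝ᵥ s| ∂gaussianVector ι = √(2 / Real.pi) * √(r ⬝ᵥ r) := by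
  have h0 : 0 ≤ r ⬝ᵥ r := by simpa using dotProduct_star_self_nonneg r
  have hm : Measurable fun s : ι → ℝ => r ⬝ᵥ s := by unfold dotProduct; fun_prop
  have h1 : gaussianReal 0 (r ⬝ᵥ r).toNNReal = (gaussianReal 0 1).map (fun x => √(r ⬝ᵥ r) * x) := by
    rw [gaussianReal_map_const_mul, mul_zero]
    congr 1
    ext
    simp [Real.sq_sqrt h0, h0]
  rw [← integral_map (f := fun x : ℝ => |x|) hm.aemeasurable (by fun_prop),
    map_dotProduct_gaussianVector, h1, integral_map (by fun_prop) (by fun_prop)]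
  simp only [abs_mul, abs_of_nonneg (Real.sqrt_nonneg _)]
  rw [integral_const_mul, integral_abs_gaussianReal, mul_comm]

lemma integrable_mul_eval_gaussianVector (i j : ι) :
    Integrable (fun s : ι → ℝ => s i * s j) (gaussianVector ι) := by
  have h : ∀ i, MemLp (fun s : ι → ℝ => s i) 2 (gaussianVector ι) := fun i =>
    (memLp_id_gaussianReal' (μ := 0) (v := 1) 2 (by simp)).comp_measurePreserving
      (measurePreserving_eval (fun _ => gaussianReal 0 1) i)
  exact (h i).integrable_mul (h j)

lemma integrable_abs_dotProduct_gaussianVector (r : ι → ℝ) :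
    Integrable (fun s : ι → ℝ => |r ⬝ᵥ s|) (gaussianVector ι) := by
  have h : ∀ i, Integrable (fun s : ι → ℝ => s i) (gaussianVector ι) := fun i =>
    ((memLp_id_gaussianReal' (μ := 0) (v := 1) 1 (by simp)).comp_measurePreserving
      (measurePreserving_eval (fun _ => gaussianReal 0 1) i)).integrable le_rfl
  exact (integrable_finsetSum _ fun i _ => (h i).const_mul (r i)).abs

end StdGaussianVector

/-! ### Fourth mixed moments -/

section MixedMoments

variable {ι : Type*} [Fintype ι]

lemma integrable_prod_pow_gaussianVector (c : ι → ℕ) :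
    Integrable (fun s : ι → ℝ => ∏ a, s a ^ c a) (gaussianVector ι) :=
  Integrable.fintype_prod (f := fun a x => x ^ c a) fun a => integrable_pow_gaussianReal (c a)

lemma integral_prod_pow_gaussianVector (c : ι → ℕ) :
    ∫ s, ∏ a, s a ^ c a ∂gaussianVector ι = ∏ a, ∫ x, x ^ c a ∂gaussianReal 0 1 :=
  integral_fintype_prod_eq_prod fun a x => x ^ c a

variable [DecidableEq ι]

lemma prod_pow_single (s : ι → ℝ) (i : ι) : ∏ a, s a ^ (if a = i then 1 else 0) = s i := by
  simp [pow_ite]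

lemma integral_mul_eval_gaussianVector (i j : ι) :
    ∫ s, s i * s j ∂gaussianVector ι = if i = j then 1 else 0 := by
  have h : ∀ s : ι → ℝ, s i * s j
      = ∏ a, s a ^ ((if a = i then 1 else 0) + (if a = j then 1 else 0)) := fun s => by
    simp only [pow_add, Finset.prod_mul_distrib, prod_pow_single]
  simp only [h, integral_prod_pow_gaussianVector]
  split_ifs with hij
  · subst hij
    refine Finset.prod_eq_one fun a _ => ?_
    split_ifs <;> simp [integral_sq_gaussianReal]
  · refine Finset.prod_eq_zero (Finset.mem_univ i) ?_
    simp [hij]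

/-- Collecting exponents coordinate by coordinate lets the product measure factor the expectation,
whatever coincidences occur among the indices. -/
lemma four_mul_eq_prod_pow (s : ι → ℝ) (i j k l : ι) : s i * s j * (s k * s l)
    = ∏ a, s a ^ ((if a = i then 1 else 0) + (if a = j then 1 else 0) +
        ((if a = k then 1 else 0) + (if a = l then 1 else 0))) := by
  simp only [pow_add, Finset.prod_mul_distrib, prod_pow_single]

lemma integrable_four_mul_gaussianVector (i j k l : ι) :
    Integrable (fun s : ι → ℝ => s i * s j * (s k * s l)) (gaussianVector ι) := by
  simp only [four_mul_eq_prod_pow]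
  exact integrable_prod_pow_gaussianVector _

/-- Isserlis' formula for fourth moments of a standard Gaussian vector. -/
lemma integral_four_mul_gaussianVector (i j k l : ι) :
    ∫ s, s i * s j * (s k * s l) ∂gaussianVector ι =
      (if i = j then 1 else 0) * (if k = l then 1 else 0)
      + (if i = k then 1 else 0) * (if j = l then 1 else 0)
      + (if i = l then 1 else 0) * (if j = k then 1 else 0) := by
  have h1 : ∫ x, x ^ 1 ∂gaussianReal 0 1 = 0 := integral_pow_odd_gaussianReal (by decide)
  have h3 : ∫ x, x ^ 3 ∂gaussianReal 0 1 = 0 := integral_pow_odd_gaussianReal (by decide)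
  have h2 := integral_sq_gaussianReal
  have h4 := integral_pow_four_gaussianReal
  simp only [four_mul_eq_prod_pow, integral_prod_pow_gaussianVector]
  by_cases hij : i = j
  · subst hij
    by_cases hkl : k = l
    · subst hkl
      by_cases hik : i = k
      · subst hik
        rw [Finset.prod_eq_single i]
        · simp only [if_true, Nat.reduceAdd, h4]; norm_num
        · intro a _ ha; simp [ha]
        · simp
      · rw [Finset.prod_eq_one]
        · simp [hik]
        · intro a _
          by_cases hai : a = i
          · subst hai; simp [hik, h2]
          · by_cases hak : a = k
            · subst hak; simp [hai, h2]
            · simp [hai, hak]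
    · by_cases hik : i = k
      · subst hik
        rw [Finset.prod_eq_zero (Finset.mem_univ i)]
        · simp [hkl]
        · simp [hkl, h3]
      · rw [Finset.prod_eq_zero (Finset.mem_univ k)]
        · simp [hkl, hik]
        · simp [hkl, Ne.symm hik]
  · by_cases hik : i = k
    · subst hik
      by_cases hjl : j = l
      · subst hjl
        rw [Finset.prod_eq_one]
        · simp [hij]
        · intro a _
          by_cases hai : a = i
          · subst hai; simp [hij, h2]
          · by_cases hak : a = j
            · subst hak; simp [hai, h2]
            · simp [hai, hak]
      · rw [Finset.prod_eq_zero (Finset.mem_univ j)]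
        · simp [hij, Ne.symm hij, hjl]
        · simp [hjl, Ne.symm hij]
    · by_cases hil : i = l
      · subst hil
        by_cases hjk : j = k
        · subst hjk
          rw [Finset.prod_eq_one]
          · simp [hij]
          · intro a _
            by_cases hai : a = i
            · subst hai; simp [hij, h2]
            · by_cases hak : a = j
              · subst hak; simp [hai, h2]
              · simp [hai, hak]
        · rw [Finset.prod_eq_zero (Finset.mem_univ j)]
          · simp [hij, hik, hjk]
          · simp [hjk, Ne.symm hij]
      · rw [Finset.prod_eq_zero (Finset.mem_univ i)]
        · simp [hij, hik, hil]
        · simp [hij, hik, hil]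

end MixedMoments

/-! ### Gaussian quadratic forms -/

section QuadraticForm

open Matrix

variable {ι : Type*} [Fintype ι]

lemma dotProduct_mulVec_eq_sum (C : Matrix ι ι ℝ) (s : ι → ℝ) :
    s ⬝ᵥ C *ᵥ s = ∑ i, ∑ j, C i j * (s i * s j) := by
  simp only [dotProduct, mulVec, Finset.mul_sum]
  exact Finset.sum_congr rfl fun i _ => Finset.sum_congr rfl fun j _ => by ring

lemma integrable_quadraticForm_gaussianVector (C : Matrix ι ι ℝ) :
    Integrable (fun s => s ⬝ᵥ C *ᵥ s) (gaussianVector ι) := by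
  simp only [dotProduct_mulVec_eq_sum]
  exact integrable_finsetSum _ fun i _ => integrable_finsetSum _ fun j _ =>
    (integrable_mul_eval_gaussianVector i j).const_mul _

lemma integral_quadraticForm_gaussianVector (C : Matrix ι ι ℝ) :
    ∫ s, s ⬝ᵥ C *ᵥ s ∂gaussianVector ι = C.trace := by
  classical
  simp only [dotProduct_mulVec_eq_sum]
  have hI := fun i j => (integrable_mul_eval_gaussianVector (ι := ι) i j).const_mul (C i j)
  rw [integral_finsetSum _ fun i _ => integrable_finsetSum _ fun j _ => hI i j]
  refine Finset.sum_congr rfl fun i _ => ?_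
  rw [integral_finsetSum _ fun j _ => hI i j]
  simp [integral_const_mul, integral_mul_eval_gaussianVector]

lemma quadraticForm_sq_eq_sum (C : Matrix ι ι ℝ) (s : ι → ℝ) :
    (s ⬝ᵥ C *ᵥ s) ^ 2 = ∑ i, ∑ j, ∑ k, ∑ l, C i j * C k l * (s i * s j * (s k * s l)) := by
  simp only [dotProduct_mulVec_eq_sum, sq, Finset.sum_mul, Finset.mul_sum]
  exact Finset.sum_congr rfl fun i _ => Finset.sum_congr rfl fun j _ =>
    Finset.sum_congr rfl fun k _ => Finset.sum_congr rfl fun l _ => by ring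

lemma integrable_quadraticForm_sq_gaussianVector (C : Matrix ι ι ℝ) :
    Integrable (fun s => (s ⬝ᵥ C *ᵥ s) ^ 2) (gaussianVector ι) := by
  classical
  simp only [quadraticForm_sq_eq_sum]
  exact integrable_finsetSum _ fun i _ => integrable_finsetSum _ fun j _ =>
    integrable_finsetSum _ fun k _ => integrable_finsetSum _ fun l _ =>
      (integrable_four_mul_gaussianVector i j k l).const_mul _

/-- The three terms are the three pairings in Isserlis' formula. -/
lemma integral_quadraticForm_sq_gaussianVector (C : Matrix ι ι ℝ) :
    ∫ s, (s ⬝ᵥ C *ᵥ s) ^ 2 ∂gaussianVector ι = C.trace ^ 2 + C.entrySq + (C * C).trace := by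
  classical
  have hI := fun i j k l => (integrable_four_mul_gaussianVector (ι := ι) i j k l).const_mul
    (C i j * C k l)
  simp only [quadraticForm_sq_eq_sum]
  have : ∫ s, ∑ i, ∑ j, ∑ k, ∑ l, C i j * C k l * (s i * s j * (s k * s l)) ∂gaussianVector ι
      = ∑ i, ∑ j, ∑ k, ∑ l, C i j * C k l * ((if i = j then 1 else 0) * (if k = l then 1 else 0)
      + (if i = k then 1 else 0) * (if j = l then 1 else 0)
      + (if i = l then 1 else 0) * (if j = k then 1 else 0)) := by
    rw [integral_finsetSum _ fun i _ => integrable_finsetSum _ fun j _ =>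
      integrable_finsetSum _ fun k _ => integrable_finsetSum _ fun l _ => hI i j k l]
    refine Finset.sum_congr rfl fun i _ => ?_
    rw [integral_finsetSum _ fun j _ =>
      integrable_finsetSum _ fun k _ => integrable_finsetSum _ fun l _ => hI i j k l]
    refine Finset.sum_congr rfl fun j _ => ?_
    rw [integral_finsetSum _ fun k _ => integrable_finsetSum _ fun l _ => hI i j k l]
    refine Finset.sum_congr rfl fun k _ => ?_
    rw [integral_finsetSum _ fun l _ => hI i j k l]
    refine Finset.sum_congr rfl fun l _ => ?_
    rw [integral_const_mul, integral_four_mul_gaussianVector]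
  rw [this]
  simp only [mul_add, Finset.sum_add_distrib]
  congr 1
  · congr 1
    · simp [trace, sq, Finset.sum_mul_sum]
    · simp [entrySq, sq]
  · simp [trace, mul_apply]

/-- The second moment of a centred quadratic form in a standard Gaussian vector. -/
lemma integral_sub_trace_sq_gaussianVector_le (C : Matrix ι ι ℝ) :
    ∫ s, (s ⬝ᵥ C *ᵥ s - C.trace) ^ 2 ∂gaussianVector ι ≤ 2 * C.entrySq := by
  have h : ∀ s : ι → ℝ, (s ⬝ᵥ C *ᵥ s - C.trace) ^ 2
      = (s ⬝ᵥ C *ᵥ s) ^ 2 - 2 * C.trace * (s ⬝ᵥ C *ᵥ s) + C.trace ^ 2 := fun s => by ring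
  simp only [h]
  have h1 := integrable_quadraticForm_sq_gaussianVector C
  have h2 := (integrable_quadraticForm_gaussianVector C).const_mul (2 * C.trace)
  have h3 : Integrable (fun s => (s ⬝ᵥ C *ᵥ s) ^ 2 - 2 * C.trace * (s ⬝ᵥ C *ᵥ s))
    (gaussianVector ι) := h1.sub h2
  rw [integral_add h3 (integrable_const _), integral_sub h1 h2, integral_const_mul,
    integral_quadraticForm_gaussianVector, integral_quadraticForm_sq_gaussianVector]
  have := C.trace_sq_le_entrySq
  simp
  linarith

end QuadraticForm

/-! ### Expected norm of the Nyström residual -/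

section Residual

open Matrix

variable {m : Type*} [Fintype m]

lemma measurable_deflate {α : Type*} [MeasurableSpace α] {R : α → Matrix m m ℝ} {s : α → m → ℝ}
    (hR : ∀ i j, Measurable fun a => R a i j) (hs : ∀ i, Measurable fun a => s a i) (i j : m) :
    Measurable fun a => (R a).deflate (s a) i j := by
  simp only [deflate, Matrix.sub_apply, Matrix.smul_apply, vecMulVec_apply, mulVec, vecMul, dotProduct,
    smul_eq_mul]
  fun_prop

lemma measurable_residual {n : ℕ} {α : Type*} [MeasurableSpace α] {R : α → Matrix m m ℝ}
    {s : α → Fin n → m → ℝ} (hR : ∀ i j, Measurable fun a => R a i j)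
    (hs : ∀ k i, Measurable fun a => s a k i) (i j : m) :
    Measurable fun a => (R a).residual (s a) i j := by
  induction n generalizing R with
  | zero => exact hR i j
  | succ n ih => exact ih (measurable_deflate hR (hs 0)) fun k => hs k.succ

lemma measurable_entrySq {m n : Type*} [Fintype m] [Fintype n] {α : Type*} [MeasurableSpace α]
    {R : α → Matrix m n ℝ} (hR : ∀ i j, Measurable fun a => R a i j) :
    Measurable fun a => (R a).entrySq := by
  simp only [entrySq]
  fun_prop

variable {R : Matrix m m ℝ}

/-- Lower bound for the expected decrease of the trace by one Gaussian deflation step. -/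
lemma le_integral_trace_decrease (hR : R.PosSemidef) (ht : 0 < R.trace)
    (hI : Integrable (fun s => (R *ᵥ s ⬝ᵥ R *ᵥ s) / (s ⬝ᵥ R *ᵥ s)) (gaussianVector m)) :
    2 / Real.pi * (R.entrySq / R.trace) ≤
      ∫ s, (R *ᵥ s ⬝ᵥ R *ᵥ s) / (s ⬝ᵥ R *ᵥ s) ∂gaussianVector m := by
  set f := R.entrySq with hf
  set t := R.trace with htdef
  set β := √(2 / Real.pi) with hβ
  have hβ0 : 0 ≤ β := Real.sqrt_nonneg _
  have hβ2 : β ^ 2 = 2 / Real.pi := Real.sq_sqrt (by positivity)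
  have hf0 : 0 ≤ f := R.entrySq_nonneg
  have hfs : √f ^ 2 = f := Real.sq_sqrt hf0
  -- This maximises `2 α β √f - α² t`, the lower bound obtained below; the maximum is `β² f / t`.
  set α := β * √f / t with hα
  have hα0 : 0 ≤ α := by positivity
  -- `W / √f` bounds `‖R s‖` from below by Cauchy–Schwarz over the rows, and its expectation is
  -- explicit because each `R i ⬝ᵥ s` is Gaussian; the constant `2/π` is the square of `E |g| = β`.
  let W : (m → ℝ) → ℝ := fun s => ∑ i, √(R i ⬝ᵥ R i) * |R i ⬝ᵥ s|
  have hWI : Integrable W (gaussianVector m) := integrable_finsetSum _ fun i _ =>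
    (integrable_abs_dotProduct_gaussianVector (R i)).const_mul _
  have hrow : ∀ i, 0 ≤ R i ⬝ᵥ R i := fun i => by simpa using dotProduct_star_self_nonneg (R i)
  have hfrow : f = ∑ i, R i ⬝ᵥ R i := by simp [hf, entrySq, dotProduct, sq]
  have hWint : ∫ s, W s ∂gaussianVector m = β * f := by
    rw [integral_finsetSum _ fun i _ =>
      (integrable_abs_dotProduct_gaussianVector (R i)).const_mul _, hfrow, Finset.mul_sum]
    refine Finset.sum_congr rfl fun i _ => ?_
    rw [integral_const_mul, integral_abs_dotProduct_gaussianVector, mul_left_comm,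
      Real.mul_self_sqrt (hrow i)]
  have hWle : ∀ s, W s ≤ √f * √(R *ᵥ s ⬝ᵥ R *ᵥ s) := fun s => by
    have := Real.sum_mul_le_sqrt_mul_sqrt Finset.univ (fun i => √(R i ⬝ᵥ R i)) fun i => |R i ⬝ᵥ s|
    refine this.trans_eq ?_
    simp only [Real.sq_sqrt (hrow _), sq_abs, ← hfrow]
    congr 2
    simp [dotProduct, mulVec, sq]
  -- The ratio `N / d` is removed by `N / d ≥ 2 α √N - α² d`, that is, `(√N - α d)² ≥ 0`.
  have hpt : ∀ s, 2 * α * (√f)⁻¹ * W s - α ^ 2 * (s ⬝ᵥ R *ᵥ s)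
      ≤ (R *ᵥ s ⬝ᵥ R *ᵥ s) / (s ⬝ᵥ R *ᵥ s) := fun s => by
    set N := R *ᵥ s ⬝ᵥ R *ᵥ s with hN
    have hN0 : 0 ≤ N := by simpa using dotProduct_star_self_nonneg (R *ᵥ s)
    have hNs : √N ^ 2 = N := Real.sq_sqrt hN0
    have h1 : (√f)⁻¹ * W s ≤ √N := by
      rcases (Real.sqrt_nonneg f).eq_or_lt with h | h
      · rw [← h]; simp
      · rw [inv_mul_le_iff₀ h]; exact hWle s
    have h2 : 2 * α * (√f)⁻¹ * W s ≤ 2 * α * √N := by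
      rw [mul_assoc]; gcongr
    rcases (hR.quad_nonneg s).eq_or_lt with hD | hD
    · have hz : √N = 0 := by simp [hN, hR.mulVec_eq_zero hD.symm]
      rw [hz] at h2
      rw [← hD]; simpa using h2
    · rw [le_div_iff₀ hD]
      nlinarith [sq_nonneg (√N - α * (s ⬝ᵥ R *ᵥ s))]
  have hQ := integrable_quadraticForm_gaussianVector R
  have hle := integral_mono ((hWI.const_mul (2 * α * (√f)⁻¹)).sub (hQ.const_mul (α ^ 2))) hI hpt
  simp only [Pi.sub_apply] at hle
  rw [integral_sub (hWI.const_mul _) (hQ.const_mul _), integral_const_mul, integral_const_mul,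
    hWint, integral_quadraticForm_gaussianVector, ← htdef] at hle
  have hff : (√f)⁻¹ * f = √f := by
    rcases (Real.sqrt_nonneg f).eq_or_lt with h | h
    · rw [← h]; have : f = 0 := by rw [← hfs, ← h]; norm_num
      simp [this]
    · rw [inv_mul_eq_iff_eq_mul₀ h.ne', ← sq, hfs]
  have e : 2 * α * (√f)⁻¹ * (β * f) - α ^ 2 * t = 2 / Real.pi * (f / t) := by
    rw [show 2 * α * (√f)⁻¹ * (β * f) = 2 * α * β * ((√f)⁻¹ * f) by ring, hff, ← hβ2, hα,
      ← hfs, Real.sqrt_sq (Real.sqrt_nonneg f)]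
    field_simp
    ring
  rwa [e] at hle

lemma integral_trace_deflate_sq_le [DecidableEq m] (hR : R.PosSemidef) (ht : 0 < R.trace) :
    Integrable (fun s => (R.deflate s).trace ^ 2) (gaussianVector m) ∧
    ∫ s, (R.deflate s).trace ^ 2 ∂gaussianVector m ≤
      R.trace ^ 2 - (2 * R.trace - √R.entrySq) * (2 / Real.pi * (R.entrySq / R.trace)) := by
  set f := R.entrySq with hf
  set t := R.trace with htdef
  set X : (m → ℝ) → ℝ := fun s => (R *ᵥ s ⬝ᵥ R *ᵥ s) / (s ⬝ᵥ R *ᵥ s) with hX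
  have hX0 : ∀ s, 0 ≤ X s := fun s =>
    div_nonneg (by simpa using dotProduct_star_self_nonneg (R *ᵥ s)) (hR.quad_nonneg s)
  have hX1 : ∀ s, X s ≤ √f := fun s => by
    rcases (hR.quad_nonneg s).eq_or_lt with hD | hD
    · simp [hX, ← hD]
    · rw [hX, div_le_iff₀ hD]; exact hR.dotProduct_self_mulVec_le s
  have hft : √f ≤ t := Real.sqrt_le_iff.mpr ⟨ht.le, hR.entrySq_le_trace_sq⟩
  have hXm : Measurable X := by
    simp only [hX, dotProduct, mulVec]; fun_prop
  have hXI : Integrable X (gaussianVector m) :=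
    .of_bound hXm.aestronglyMeasurable (√f) (.of_forall fun s => by
      rw [Real.norm_of_nonneg (hX0 s)]; exact hX1 s)
  have htr : ∀ s, (R.deflate s).trace = t - X s := fun s => hR.trace_deflate s
  simp only [htr]
  have hI : Integrable (fun s => (t - X s) ^ 2) (gaussianVector m) := by
    refine .of_bound (by fun_prop) (t ^ 2) (.of_forall fun s => ?_)
    rw [Real.norm_of_nonneg (sq_nonneg _)]
    have := hX0 s; have := hX1 s
    exact pow_le_pow_left₀ (by linarith) (by linarith) 2
  refine ⟨hI, ?_⟩
  -- Since `0 ≤ X ≤ √f`, `X² ≤ √f X` makes the square linear in `X`, so only a lower bound on `E X`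
  -- is needed.
  have h1 := integral_mono hI ((integrable_const (t ^ 2)).sub (hXI.const_mul (2 * t - √f)))
    fun s => (show (t - X s) ^ 2 ≤ t ^ 2 - (2 * t - √f) * X s by
      nlinarith [mul_nonneg (hX0 s) (sub_nonneg.mpr (hX1 s))])
  simp only [Pi.sub_apply] at h1
  rw [integral_sub (integrable_const _) (hXI.const_mul _), integral_const_mul] at h1
  simp only [integral_const, probReal_univ, one_smul] at h1
  have h2 := mul_le_mul_of_nonneg_left (le_integral_trace_decrease hR ht hXI)
    (show 0 ≤ 2 * t - √f by linarith)
  linarith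

/-- Fubini: the first sketching vector is independent of the rest, so the induction hypothesis can
be applied to the deflated matrix with that vector fixed. -/
lemma lintegral_residual_succ {n : ℕ} (R : Matrix m m ℝ) :
    ∫⁻ s, ENNReal.ofReal (R.residual s).entrySq ∂Measure.pi (fun _ : Fin (n + 1) => gaussianVector m)
      = ∫⁻ s₀, ∫⁻ s, ENNReal.ofReal ((R.deflate s₀).residual s).entrySq
          ∂Measure.pi (fun _ : Fin n => gaussianVector m) ∂gaussianVector m := by
  have hm : Measurable fun p : (m → ℝ) × (Fin n → m → ℝ) =>
      ENNReal.ofReal ((R.deflate p.1).residual p.2).entrySq := by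
    refine (measurable_entrySq fun i j => ?_).ennreal_ofReal
    refine measurable_residual (R := fun p : (m → ℝ) × (Fin n → m → ℝ) => R.deflate p.1)
      (s := Prod.snd) ?_ (fun k i => by fun_prop) i j
    exact measurable_deflate (R := fun _ => R) (s := Prod.fst) (fun _ _ => measurable_const)
      fun i => by fun_prop
  have hmp := measurePreserving_piFinSuccAbove (fun _ : Fin (n + 1) => gaussianVector m) 0
  rw [← lintegral_prod _ hm.aemeasurable]
  refine Eq.trans (lintegral_congr fun s => ?_) (hmp.lintegral_comp hm)
  have e : MeasurableEquiv.piFinSuccAbove (fun _ : Fin (n + 1) => m → ℝ) 0 s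
    = (s 0, Fin.tail s) := rfl
  rw [e, Matrix.residual]

/-- One step of the induction on the number of sketching vectors. -/
lemma lintegral_residual_succ_le [DecidableEq m] {n : ℕ} {a b v : ℝ} (ha : 0 < a) (hb : 0 < b)
    (hv0 : 0 < v) (hv1 : v ≤ 1) (hbv : 1 ≤ b * v ^ 2) (hab : b - a ≤ 2 / Real.pi * (2 - v))
    (ih : ∀ R : Matrix m m ℝ, R.PosSemidef → ∫⁻ s, ENNReal.ofReal (R.residual s).entrySq
      ∂Measure.pi (fun _ : Fin n => gaussianVector m) ≤ ENNReal.ofReal (R.trace ^ 2 / a))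
    {R : Matrix m m ℝ} (hR : R.PosSemidef) :
    ∫⁻ s, ENNReal.ofReal (R.residual s).entrySq
      ∂Measure.pi (fun _ : Fin (n + 1) => gaussianVector m) ≤ ENNReal.ofReal (R.trace ^ 2 / b) := by
  -- If the norm already meets the target, monotonicity under deflation suffices. Otherwise `u = √f
  -- / t` satisfies `b u² > 1`.
  rcases le_or_gt R.entrySq (R.trace ^ 2 / b) with hle | hlt
  · calc _ ≤ ∫⁻ _, ENNReal.ofReal (R.trace ^ 2 / b)
          ∂Measure.pi (fun _ : Fin (n + 1) => gaussianVector m) := lintegral_mono fun s =>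
          ENNReal.ofReal_le_ofReal ((hR.entrySq_residual_le s).trans hle)
      _ = _ := by simp
  have ht : 0 < R.trace := by
    refine lt_of_le_of_ne hR.trace_nonneg fun h => ?_
    have := hR.entrySq_le_trace_sq
    rw [← h] at this hlt
    norm_num at this hlt
    linarith
  obtain ⟨hI, hle⟩ := integral_trace_deflate_sq_le hR ht
  rw [lintegral_residual_succ]
  calc _ ≤ ∫⁻ s₀, ENNReal.ofReal ((R.deflate s₀).trace ^ 2 / a) ∂gaussianVector m :=
        lintegral_mono fun s₀ => ih _ (hR.deflate s₀)
    _ = ENNReal.ofReal (∫ s₀, (R.deflate s₀).trace ^ 2 / a ∂gaussianVector m) :=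
        (ofReal_integral_eq_lintegral_ofReal (hI.div_const a)
          (.of_forall fun s => by positivity)).symm
    _ ≤ _ := by
        refine ENNReal.ofReal_le_ofReal ?_
        rw [integral_div, div_le_iff₀ ha]
        refine hle.trans ?_
        set t := R.trace
        have hft : √R.entrySq ≤ t := Real.sqrt_le_iff.mpr ⟨ht.le, hR.entrySq_le_trace_sq⟩
        obtain ⟨u, hu⟩ : ∃ u, √R.entrySq = u * t := ⟨√R.entrySq / t, by field_simp⟩
        have hf : R.entrySq = (u * t) ^ 2 := by rw [← hu, Real.sq_sqrt R.entrySq_nonneg]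
        have hu0 : 0 ≤ u := by
          have := Real.sqrt_nonneg R.entrySq
          rw [hu] at this
          exact nonneg_of_mul_nonneg_left this ht
        have hu1 : u ≤ 1 := by
          rw [hu] at hft
          exact le_of_mul_le_mul_right (by linarith) ht
        have hub : 1 < b * u ^ 2 := by
          rw [hf, div_lt_iff₀ hb] at hlt
          have : t ^ 2 * 1 < t ^ 2 * (b * u ^ 2) := by nlinarith
          exact lt_of_mul_lt_mul_left this (by positivity)
        -- For `u ≤ v` use `b u² > 1`. For `u ≥ v` use that `x² (2 - x)` increases on `[0, 1]`,
        -- together with `b v² ≥ 1`.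
        have key : 2 - v ≤ b * u ^ 2 * (2 - u) := by
          rcases le_total u v with h | h
          · nlinarith
          · have h1 : v ^ 2 * (2 - v) ≤ u ^ 2 * (2 - u) := by
              have h2 : 0 ≤ 2 * (u + v) - (u ^ 2 + u * v + v ^ 2) := by nlinarith
              nlinarith [mul_nonneg (sub_nonneg.mpr h) h2]
            have h3 := mul_le_mul_of_nonneg_left h1 hb.le
            nlinarith
        have hpi : 0 < 2 / Real.pi := by positivity
        have key2 : b - a ≤ 2 / Real.pi * (b * u ^ 2 * (2 - u)) :=
          hab.trans (mul_le_mul_of_nonneg_left key hpi.le)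
        rw [hu, hf]
        have e : t ^ 2 - (2 * t - u * t) * (2 / Real.pi * ((u * t) ^ 2 / t))
            = t ^ 2 / b * (b - 2 / Real.pi * (b * u ^ 2 * (2 - u))) := by
          field_simp
        rw [e]
        have : 0 ≤ t ^ 2 / b := by positivity
        exact mul_le_mul_of_nonneg_left (by linarith) this

lemma two_div_pi_gt : (0.634 : ℝ) < 2 / Real.pi := by
  rw [lt_div_iff₀ Real.pi_pos]
  have := Real.pi_lt_d2
  linarith

/-- A bound valid from `n = 0`, where `n - 1` is useless. Its slope is below `1` because `u` may be
close to `1` for small `n`, which weakens the factor `2 - u` in the decrease. -/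
lemma lintegral_residual_le_slope [DecidableEq m] (n : ℕ) {R : Matrix m m ℝ} (hR : R.PosSemidef) :
    ∫⁻ s, ENNReal.ofReal (R.residual s).entrySq ∂Measure.pi (fun _ : Fin n => gaussianVector m)
      ≤ ENNReal.ofReal (R.trace ^ 2 / (1 + 3 / 4 * n)) := by
  induction n generalizing R with
  | zero =>
    simp only [Matrix.residual, lintegral_const, measure_univ, mul_one]
    refine ENNReal.ofReal_le_ofReal ?_
    simpa using hR.entrySq_le_trace_sq
  | succ n ih =>
    have hn : (0 : ℝ) ≤ n := n.cast_nonneg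
    -- `v` is just above `1 / √1.75`, the worst case `b = 1.75` being at `n = 0`; the increment
    -- condition is `0.75 ≤ (2/π)(2 - v)`.
    refine lintegral_residual_succ_le (a := 1 + 3 / 4 * n) (v := 0.756) (by positivity)
      (by positivity) (by norm_num) (by norm_num) ?_ ?_ (fun R hR => ih hR) hR
    · push_cast; nlinarith
    · push_cast; linarith [two_div_pi_gt]

/-- At `n = 8` the two denominators `1 + 3 n / 4` and `n - 1` agree. From there on the decrease is
strong enough for slope `1`. -/
lemma lintegral_residual_le_of_eight_le [DecidableEq m] {n : ℕ} (hn : 8 ≤ n) {R : Matrix m m ℝ}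
    (hR : R.PosSemidef) :
    ∫⁻ s, ENNReal.ofReal (R.residual s).entrySq ∂Measure.pi (fun _ : Fin n => gaussianVector m)
      ≤ ENNReal.ofReal (R.trace ^ 2 / (n - 1)) := by
  induction n, hn using Nat.le_induction generalizing R with
  | base => refine (lintegral_residual_le_slope 8 hR).trans_eq ?_; norm_num
  | succ n hn ih =>
    have hn : (8 : ℝ) ≤ n := by exact_mod_cast hn
    -- `v` is just above `1 / √8`, the smallest target denominator being `b = 8`.
    refine lintegral_residual_succ_le (a := n - 1) (v := 0.354) (by linarith)
      (by push_cast; linarith) (by norm_num) (by norm_num) ?_ ?_ (fun R hR => ih hR) hR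
    · push_cast; nlinarith
    · push_cast; linarith [two_div_pi_gt]

/-- The expected squared Frobenius norm of the residual of the Nyström approximation with `n`
Gaussian sketching vectors. -/
theorem lintegral_residual_le [DecidableEq m] {n : ℕ} (hn : 2 ≤ n) {R : Matrix m m ℝ}
    (hR : R.PosSemidef) :
    ∫⁻ s, ENNReal.ofReal (R.residual s).entrySq ∂Measure.pi (fun _ : Fin n => gaussianVector m)
      ≤ ENNReal.ofReal (R.trace ^ 2 / (n - 1)) := by
  rcases le_total 8 n with h | h
  · exact lintegral_residual_le_of_eight_le h hR
  · refine (lintegral_residual_le_slope n hR).trans (ENNReal.ofReal_le_ofReal ?_)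
    have h2 : (2 : ℝ) ≤ n := by exact_mod_cast hn
    have h8 : (n : ℝ) ≤ 8 := by exact_mod_cast h
    exact div_le_div_of_nonneg_left (sq_nonneg _) (by linarith) (by linarith)

end Residual

/-! ### The sketch projection and the error of the estimator -/

section Projection

open Matrix

variable {D n : ℕ}

/-- The orthogonal projection onto the complement of the span of the vectors `s j`. -/
noncomputable def complProj (s : Fin n → Fin D → ℝ) : Matrix (Fin D) (Fin D) ℝ :=
  (1 : Matrix (Fin D) (Fin D) ℝ).residual s

lemma complProj_transpose (s : Fin n → Fin D → ℝ) : (complProj s)ᵀ = complProj s :=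
  (PosSemidef.one.residual s).transpose_eq

lemma complProj_mulVec (s : Fin n → Fin D → ℝ) (j : Fin n) : complProj s *ᵥ s j = 0 :=
  PosSemidef.one.residual_mulVec_self s j

lemma mul_complProj {l : Type*} (L : Matrix l (Fin D) ℝ) (s : Fin n → Fin D → ℝ)
    (h : ∀ j, L *ᵥ s j = 0) : L * complProj s = L := by
  rw [complProj, mul_residual L s (by simpa using h), Matrix.mul_one]

lemma complProj_mul_self (s : Fin n → Fin D → ℝ) : complProj s * complProj s = complProj s :=
  mul_complProj _ s (complProj_mulVec s)

/-- A QR basis of `M` determines the projection onto the column space of `M`. -/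
lemma IsQRBasis.one_sub_mul_transpose {r : ℕ} {M : Matrix (Fin D) (Fin n) ℝ}
    {Q : Matrix (Fin D) (Fin r) ℝ} (h : IsQRBasis M Q) : 1 - Q * Qᵀ = complProj M.col := by
  have h1 : ∀ j, (1 - Q * Qᵀ) *ᵥ M.col j = 0 := fun j => by
    have hj : M.col j ∈ LinearMap.range Q.mulVecLin := by
      rw [h.range_eq]
      exact ⟨Pi.single j 1, by simp⟩
    obtain ⟨z, hz⟩ := hj
    rw [← hz, mulVecLin_apply, mulVec_mulVec, Matrix.sub_mul, Matrix.mul_assoc, h.orthonormal]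
    simp
  have h2 : complProj M.col * M = 0 := by
    ext i j
    exact congrFun (complProj_mulVec M.col j) i
  have h3 : complProj M.col * Q = 0 := by
    refine ext_of_mulVec_single fun j => ?_
    have hj : Q *ᵥ Pi.single j 1 ∈ LinearMap.range M.mulVecLin := by
      rw [← h.range_eq]
      exact ⟨_, rfl⟩
    obtain ⟨z, hz⟩ := hj
    rw [← mulVec_mulVec, ← hz, mulVecLin_apply, mulVec_mulVec, h2, zero_mulVec,
      zero_mulVec]
  have h4 : Qᵀ * complProj M.col = 0 := by
    rw [← complProj_transpose, ← transpose_mul, h3, transpose_zero]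
  -- With `C` the complementary projection, `1 - Q Qᵀ = (1 - Q Qᵀ) C = C - Q (Qᵀ C) = C`.
  rw [← mul_complProj _ _ h1, Matrix.sub_mul, Matrix.mul_assoc, h4]
  simp

/-- The two-sided projected matrix is controlled by the Nyström residual. -/
lemma entrySq_complProj_mul_mul_le {A : Matrix (Fin D) (Fin D) ℝ} (A' : Matrix (Fin D) (Fin D) ℝ)
    (s : Fin n → Fin D → ℝ) :
    (complProj (fun j => A *ᵥ s j) * A' * complProj (fun j => A *ᵥ s j)).entrySq
      ≤ 2 * (A.residual s).entrySq + 2 * (A' - A).entrySq := by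
  set L := complProj (fun j => A *ᵥ s j) with hL
  have hs : Lᵀ = L := complProj_transpose _
  have hi : L * L = L := complProj_mul_self _
  have hA : L * A.residual s = L * A := mul_residual L s (complProj_mulVec fun j => A *ᵥ s j)
  have e : L * A' * L = L * A.residual s * L + L * (A' - A) * L := by
    rw [hA, ← Matrix.add_mul, ← Matrix.mul_add, add_sub_cancel]
  rw [e]
  refine (entrySq_add_le _ _).trans ?_
  gcongr
  · exact entrySq_mul_mul_le hs hi _
  · exact entrySq_mul_mul_le hs hi _

lemma IsQRBasis.approxHutchPP_eq {r k : ℕ} {M : Matrix (Fin D) (Fin n) ℝ}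
    {Q : Matrix (Fin D) (Fin r) ℝ} (h : IsQRBasis M Q) (B : Matrix (Fin D) (Fin D) ℝ)
    (G : Matrix (Fin D) (Fin k) ℝ) :
    approxHutchPP B Q G = B.trace + (hutchinson (complProj M.col * B * complProj M.col) G
      - (complProj M.col * B * complProj M.col).trace) := by
  have h1 : (Qᵀ * B * Q).trace = B.trace - (complProj M.col * B * complProj M.col).trace := by
    rw [trace_mul_cycle (complProj M.col), complProj_mul_self, ← h.one_sub_mul_transpose,
      trace_mul_cycle Qᵀ, Matrix.sub_mul, Matrix.one_mul, trace_sub]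
    ring
  rw [approxHutchPP, h.one_sub_mul_transpose, h1]
  ring

/-- The matrix of the quadratic form `hutchinson B` in the entries of the probe matrix. -/
noncomputable def hutchinsonForm (n : ℕ) (B : Matrix (Fin D) (Fin D) ℝ) :
    Matrix (Fin D × Fin n) (Fin D × Fin n) ℝ :=
  blockDiagonal fun _ => (1 / (n : ℝ)) • B

lemma hutchinson_eq_quadraticForm (B : Matrix (Fin D) (Fin D) ℝ) (G : Matrix (Fin D) (Fin n) ℝ) :
    hutchinson B G = (fun p => G p.1 p.2) ⬝ᵥ hutchinsonForm n B *ᵥ fun p => G p.1 p.2 := by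
  simp only [hutchinson, hutchinsonForm, dotProduct, mulVec, blockDiagonal_apply,
    Fintype.sum_prod_type, Finset.mul_sum, Matrix.smul_apply, smul_eq_mul, col_apply]
  rw [Finset.sum_comm]
  refine Finset.sum_congr rfl fun i _ => Finset.sum_congr rfl fun j _ =>
    Finset.sum_congr rfl fun k _ => ?_
  rw [Finset.sum_eq_single j]
  · simp; ring
  · intro b _ hb; simp [Ne.symm hb]
  · simp

lemma trace_hutchinsonForm (hn : 0 < n) (B : Matrix (Fin D) (Fin D) ℝ) :
    (hutchinsonForm n B).trace = B.trace := by
  have : (n : ℝ) ≠ 0 := by exact_mod_cast hn.ne'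
  simp [hutchinsonForm, trace_blockDiagonal, trace_smul, this]

/-- There are `n` diagonal blocks, each contributing `‖B‖² / n²`. This is the source of the factor
`1 / n` in the variance. -/
lemma entrySq_hutchinsonForm (hn : 0 < n) (B : Matrix (Fin D) (Fin D) ℝ) :
    (hutchinsonForm n B).entrySq = 1 / n * B.entrySq := by
  have h0 : (n : ℝ) ≠ 0 := by exact_mod_cast hn.ne'
  have h : ∀ i j k, ∑ l, (hutchinsonForm n B) (i, j) (k, l) ^ 2 = (1 / (n : ℝ) * B i k) ^ 2 := by
    intro i j k
    rw [Finset.sum_eq_single j]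
    · simp [hutchinsonForm, blockDiagonal_apply]
    · intro b _ hb; simp [hutchinsonForm, blockDiagonal_apply, Ne.symm hb]
    · simp
  simp only [entrySq, Fintype.sum_prod_type, h, mul_pow]
  simp only [Finset.sum_const, Finset.card_univ, Fintype.card_fin, nsmul_eq_mul, Finset.mul_sum]
  refine Finset.sum_congr rfl fun i _ => Finset.sum_congr rfl fun k _ => ?_
  field_simp

end Projection

/-! ### Joint law of sketch and probes -/

section Law

lemma map_curry_gaussianVector (ι κ : Type*) [Fintype ι] [Fintype κ] :
    (gaussianVector (ι × κ)).map (MeasurableEquiv.curry ι κ ℝ) =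
      Measure.pi fun _ : ι => gaussianVector κ := by
  have h := Measure.infinitePi_map_curry (fun (_ : ι) (_ : κ) => gaussianReal 0 1)
  simpa only [Measure.infinitePi_eq_pi] using h

variable {Ω : Type*} [MeasurableSpace Ω] {P : Measure Ω} [IsProbabilityMeasure P] {D n : ℕ}
  {S G : Ω → Matrix (Fin D) (Fin n) ℝ}

/-- The joint law of the columns of the sketch and of the entries of the probe matrix. -/
lemma IsGaussianSketchAndProbes.hasLaw (h : IsGaussianSketchAndProbes P S G) :
    HasLaw (fun ω => ((fun j i => S ω i j : Fin n → Fin D → ℝ),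
        (fun p => G ω p.1 p.2 : Fin D × Fin n → ℝ)))
      ((Measure.pi fun _ : Fin n => gaussianVector (Fin D)).prod
        (gaussianVector (Fin D × Fin n))) P := by
  -- The sketch indices are swapped so that currying groups its entries by column.
  let U : (Fin n × Fin D) ⊕ (Fin D × Fin n) → Ω → ℝ :=
    Sum.elim (fun p ω => S ω p.2 p.1) (fun p ω => G ω p.1 p.2)
  have hU : iIndepFun U P := by
    have := h.indep.precomp (g := Sum.map Prod.swap id)
      (Sum.map_injective.mpr ⟨Prod.swap_injective, Function.injective_id⟩)
    convert this using 1
    ext x ω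
    rcases x with x | x <;> rfl
  have hlaw : ∀ x, HasLaw (U x) (gaussianReal 0 1) P := by
    rintro (x | x)
    · exact h.law_sketch x.2 x.1
    · exact h.law_probe x.1 x.2
  have hm := (iIndepFun_iff_map_fun_eq_pi_map fun x => (hlaw x).aemeasurable).mp hU
  simp only [(hlaw _).map_eq] at hm
  have hL : HasLaw (fun ω x => U x ω) (Measure.pi fun _ => gaussianReal 0 1) P :=
    ⟨aemeasurable_pi_lambda _ fun x => (hlaw x).aemeasurable, hm⟩
  have h1 := measurePreserving_sumPiEquivProdPi
    (fun _ : (Fin n × Fin D) ⊕ (Fin D × Fin n) => gaussianReal 0 1)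
  have h2 : MeasurePreserving (MeasurableEquiv.curry (Fin n) (Fin D) ℝ)
      (gaussianVector (Fin n × Fin D)) (Measure.pi fun _ : Fin n => gaussianVector (Fin D)) :=
    ⟨MeasurableEquiv.measurable _, map_curry_gaussianVector _ _⟩
  have h3 := (h2.prod (MeasurePreserving.id (gaussianVector (Fin D × Fin n)))).comp h1
  have h4 : HasLaw _ _ _ := ⟨h3.measurable.aemeasurable, h3.map_eq⟩
  exact h4.comp hL

end Law

lemma moments_const_add {Ω : Type*} [MeasurableSpace Ω] {P : Measure Ω} [IsProbabilityMeasure P]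
    {X : Ω → ℝ} (hX : MemLp X 2 P) (h0 : ∫ ω, X ω ∂P = 0) (a : ℝ) :
    MemLp (fun ω => a + X ω) 2 P ∧ ∫ ω, a + X ω ∂P = a ∧
      variance (fun ω => a + X ω) P = ∫ ω, X ω ^ 2 ∂P := by
  refine ⟨(memLp_const a).add hX, ?_, ?_⟩
  · rw [integral_add (integrable_const _) (hX.integrable one_le_two), h0]
    simp
  · rw [variance_const_add hX.aestronglyMeasurable,
      variance_of_integral_eq_zero hX.aestronglyMeasurable.aemeasurable h0]

/-! ### Moments of the estimator -/

section Estimator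

open Matrix

variable {D n : ℕ}

/-- The error of the approximate Hutch++ estimator, as a function of the columns of the sketch and
of the entries of the probe matrix. -/
noncomputable def hutchPPError (A A' : Matrix (Fin D) (Fin D) ℝ)
    (p : (Fin n → Fin D → ℝ) × (Fin D × Fin n → ℝ)) : ℝ :=
  p.2 ⬝ᵥ hutchinsonForm n
      (complProj (fun j => A *ᵥ p.1 j) * A' * complProj (fun j => A *ᵥ p.1 j)) *ᵥ p.2
    - (complProj (fun j => A *ᵥ p.1 j) * A' * complProj (fun j => A *ᵥ p.1 j)).trace

lemma IsQRBasis.approxHutchPP_eq_add_error {r : ℕ} {A S : Matrix _ _ ℝ}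
    {Q : Matrix (Fin D) (Fin r) ℝ} (h : IsQRBasis (A * S) Q) (A' : Matrix (Fin D) (Fin D) ℝ)
    (G : Matrix (Fin D) (Fin n) ℝ) :
    approxHutchPP A' Q G =
      A'.trace + hutchPPError A A' ((fun j i => S i j), (fun p => G p.1 p.2)) := by
  rw [h.approxHutchPP_eq, hutchinson_eq_quadraticForm]
  rfl

variable (A A' : Matrix (Fin D) (Fin D) ℝ)

lemma measurable_complProj_mul_mul (i k : Fin D) :
    Measurable fun s : Fin n → Fin D → ℝ =>
      (complProj (fun j => A *ᵥ s j) * A' * complProj (fun j => A *ᵥ s j)) i k := by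
  have h : ∀ i k, Measurable fun s : Fin n → Fin D → ℝ => complProj (fun j => A *ᵥ s j) i k := by
    refine fun i k => measurable_residual (R := fun _ => 1)
      (s := fun (s : Fin n → Fin D → ℝ) j => A *ᵥ s j) (fun _ _ => measurable_const)
      (fun j i => ?_) i k
    simp only [mulVec, dotProduct]
    fun_prop
  simp only [mul_apply]
  fun_prop

lemma measurable_quadraticForm_sub_trace {α ι κ : Type*} [MeasurableSpace α] [Fintype ι]
    [Fintype κ] {C : α → Matrix ι ι ℝ} {B : α → Matrix κ κ ℝ} {g : α → ι → ℝ}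
    (hC : ∀ i j, Measurable fun a => C a i j) (hB : ∀ i j, Measurable fun a => B a i j)
    (hg : ∀ i, Measurable fun a => g a i) :
    Measurable fun a => g a ⬝ᵥ C a *ᵥ g a - (B a).trace := by
  simp only [dotProduct, mulVec, trace, diag_apply]
  fun_prop

lemma measurable_hutchPPError : Measurable (hutchPPError (n := n) A A') := by
  have h : ∀ i k, Measurable fun p : (Fin n → Fin D → ℝ) × (Fin D × Fin n → ℝ) =>
      (complProj (fun j => A *ᵥ p.1 j) * A' * complProj (fun j => A *ᵥ p.1 j)) i k := fun i k =>
    (measurable_complProj_mul_mul A A' i k).comp measurable_fst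
  refine measurable_quadraticForm_sub_trace (fun x y => ?_) h fun x => by fun_prop
  simp only [hutchinsonForm, blockDiagonal_apply, Matrix.smul_apply, smul_eq_mul]
  split_ifs
  · exact (h _ _).const_mul _
  · exact measurable_const

/-- The law of the columns of the sketch and of the entries of the probe matrix. -/
noncomputable abbrev sketchProbeLaw (D n : ℕ) :
    Measure ((Fin n → Fin D → ℝ) × (Fin D × Fin n → ℝ)) :=
  (Measure.pi fun _ : Fin n => gaussianVector (Fin D)).prod (gaussianVector (Fin D × Fin n))

/-- For a fixed sketch the projected matrix is constant, so the bound for centred quadratic forms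
applies to the inner integral over the probes. -/
lemma lintegral_hutchPPError_sq_le (hn : 0 < n) :
    ∫⁻ p, ENNReal.ofReal (hutchPPError A A' p ^ 2) ∂sketchProbeLaw D n ≤
      ∫⁻ s, ENNReal.ofReal (2 / n * (complProj (fun j => A *ᵥ s j) * A' *
          complProj (fun j => A *ᵥ s j)).entrySq)
        ∂Measure.pi fun _ : Fin n => gaussianVector (Fin D) := by
  rw [lintegral_prod _ ((measurable_hutchPPError A A').pow_const 2).ennreal_ofReal.aemeasurable]
  refine lintegral_mono fun s => ?_
  set B := complProj (fun j => A *ᵥ s j) * A' * complProj (fun j => A *ᵥ s j) with hB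
  have htr := trace_hutchinsonForm hn B
  have hI : Integrable (fun g => (g ⬝ᵥ hutchinsonForm n B *ᵥ g - B.trace) ^ 2)
      (gaussianVector (Fin D × Fin n)) := by
    have h : ∀ g, (g ⬝ᵥ hutchinsonForm n B *ᵥ g - B.trace) ^ 2 =
        (g ⬝ᵥ hutchinsonForm n B *ᵥ g) ^ 2 - 2 * B.trace * (g ⬝ᵥ hutchinsonForm n B *ᵥ g)
          + B.trace ^ 2 := fun g => by ring
    simp only [h]
    exact ((integrable_quadraticForm_sq_gaussianVector _).sub
      ((integrable_quadraticForm_gaussianVector _).const_mul _)).add (integrable_const _)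
  change ∫⁻ g, ENNReal.ofReal ((g ⬝ᵥ hutchinsonForm n B *ᵥ g - B.trace) ^ 2) ∂_ ≤ _
  rw [← ofReal_integral_eq_lintegral_ofReal hI (.of_forall fun g => sq_nonneg _)]
  refine ENNReal.ofReal_le_ofReal ?_
  rw [← htr]
  refine (integral_sub_trace_sq_gaussianVector_le _).trans_eq ?_
  rw [entrySq_hutchinsonForm hn]
  ring

/-- Projecting does not increase the norm, so the conditional second moment is bounded by a constant
independent of the sketch. -/
lemma memLp_hutchPPError (hn : 0 < n) :
    MemLp (hutchPPError (n := n) A A') 2 (sketchProbeLaw D n) := by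
  have hm := (measurable_hutchPPError (n := n) A A')
  rw [memLp_two_iff_integrable_sq hm.aestronglyMeasurable,
    ← lintegral_ofReal_ne_top_iff_integrable (hm.pow_const 2).aestronglyMeasurable
      (.of_forall fun p => sq_nonneg _)]
  refine ne_top_of_le_ne_top ?_ ((lintegral_hutchPPError_sq_le A A' hn).trans
    (lintegral_mono fun s => ENNReal.ofReal_le_ofReal (mul_le_mul_of_nonneg_left
      (entrySq_mul_mul_le (complProj_transpose _) (complProj_mul_self _) A')
      (by positivity))))
  simp

lemma integral_hutchPPError (hn : 0 < n) :
    ∫ p, hutchPPError A A' p ∂sketchProbeLaw D n = 0 := by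
  rw [integral_prod _ ((memLp_hutchPPError A A' hn).integrable one_le_two)]
  refine integral_eq_zero_of_ae (.of_forall fun s => ?_)
  simp only [hutchPPError]
  rw [integral_sub (integrable_quadraticForm_gaussianVector _) (integrable_const _),
    integral_quadraticForm_gaussianVector, trace_hutchinsonForm hn]
  simp

lemma integral_hutchPPError_sq_le {A : Matrix (Fin D) (Fin D) ℝ} (hA : A.PosSemidef)
    (hn : 2 ≤ n) : ∫ p, hutchPPError A A' p ^ 2 ∂sketchProbeLaw D n ≤
      4 / n * (A.trace ^ 2 / (n - 1)) + 4 / n * (A' - A).entrySq := by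
  have h2 : (2 : ℝ) ≤ n := by exact_mod_cast hn
  have hn1 : (0 : ℝ) < n - 1 := by linarith
  have hI := (memLp_hutchPPError (n := n) A A' (by omega)).integrable_sq
  have hE : 0 ≤ (A' - A).entrySq := entrySq_nonneg _
  rw [← ENNReal.ofReal_le_ofReal_iff (by positivity),
    ofReal_integral_eq_lintegral_ofReal hI (.of_forall fun p => sq_nonneg _)]
  calc _ ≤ _ := lintegral_hutchPPError_sq_le A A' (by omega)
    _ ≤ ∫⁻ s, (ENNReal.ofReal (4 / n) * ENNReal.ofReal (A.residual s).entrySq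
        + ENNReal.ofReal (4 / n * (A' - A).entrySq))
          ∂Measure.pi fun _ : Fin n => gaussianVector (Fin D) := by
        refine lintegral_mono fun s => ?_
        rw [← ENNReal.ofReal_mul (by positivity), ← ENNReal.ofReal_add
          (mul_nonneg (by positivity) (entrySq_nonneg _)) (by positivity)]
        refine ENNReal.ofReal_le_ofReal ?_
        refine (mul_le_mul_of_nonneg_left (entrySq_complProj_mul_mul_le A' s)
          (by positivity)).trans_eq ?_
        ring
    _ = ENNReal.ofReal (4 / n) * ∫⁻ s, ENNReal.ofReal (A.residual s).entrySq
          ∂(Measure.pi fun _ : Fin n => gaussianVector (Fin D))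
        + ENNReal.ofReal (4 / n * (A' - A).entrySq) := by
        rw [lintegral_add_right _ measurable_const, lintegral_const_mul' _ _ ENNReal.ofReal_ne_top]
        simp
    _ ≤ ENNReal.ofReal (4 / n) * ENNReal.ofReal (A.trace ^ 2 / (n - 1))
        + ENNReal.ofReal (4 / n * (A' - A).entrySq) := by
        gcongr
        exact lintegral_residual_le hn hA
    _ = _ := by
        rw [← ENNReal.ofReal_mul (by positivity), ← ENNReal.ofReal_add
          (by positivity) (by positivity)]

/-- Moments of a random variable that differs by a constant from the error of the approximate
Hutch++ estimator. -/
lemma hutchPP_moments {Ω : Type*} [MeasurableSpace Ω] {P : Measure Ω} [IsProbabilityMeasure P]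
    {A : Matrix (Fin D) (Fin D) ℝ} (hA : A.PosSemidef) (hn : 0 < n) (a : ℝ)
    {T : Ω → (Fin n → Fin D → ℝ) × (Fin D × Fin n → ℝ)} (hT : HasLaw T (sketchProbeLaw D n) P) :
    MemLp (fun ω => a + hutchPPError A A' (T ω)) 2 P ∧
    ∫ ω, a + hutchPPError A A' (T ω) ∂P = a ∧
    (2 ≤ n → variance (fun ω => a + hutchPPError A A' (T ω)) P ≤
      4 / n * (A.trace ^ 2 / (n - 1)) + 4 / n * (A' - A).entrySq) := by
  have hm := measurable_hutchPPError (n := n) A A'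
  have hLp : MemLp (fun ω => hutchPPError A A' (T ω)) 2 P := by
    have := memLp_hutchPPError (n := n) A A' hn
    rw [← hT.map_eq] at this
    exact (memLp_map_measure_iff hm.aestronglyMeasurable hT.aemeasurable).mp this
  have hint : ∫ ω, hutchPPError A A' (T ω) ∂P = 0 := by
    have := integral_hutchPPError (n := n) A A' hn
    rwa [← hT.map_eq, integral_map hT.aemeasurable hm.aestronglyMeasurable] at this
  obtain ⟨h1, h2, h3⟩ := moments_const_add hLp hint a
  refine ⟨h1, h2, fun hn2 => h3.trans_le ?_⟩
  have hsq := integral_hutchPPError_sq_le A' hA hn2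
  rwa [← hT.map_eq, integral_map hT.aemeasurable (hm.pow_const 2).aestronglyMeasurable] at hsq

end Estimator

/-- With `m = 3k`, `4 / k = 12 / m` and `1 / (k - 1) = 3 / (m - 3)`, whence the constants `36` and
`12 c²`. -/
lemma variance_bound_eq {k : ℕ} (hk : 2 ≤ k) (t x c : ℝ) :
    36 / (((3 * k : ℕ) : ℝ) * (((3 * k : ℕ) : ℝ) - 3)) * t ^ 2
      + 1 / ((3 * k : ℕ) : ℝ) * (12 * c ^ 2 * x) =
    4 / k * (t ^ 2 / (k - 1)) + 4 / k * (c ^ 2 * x) := by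
  have hk2 : (2 : ℝ) ≤ k := by exact_mod_cast hk
  have h0 : (k : ℝ) ≠ 0 := by positivity
  have h1 : (k - 1 : ℝ) ≠ 0 := by linarith
  have h2 : (3 * k - 3 : ℝ) = 3 * (k - 1) := by ring
  push_cast
  rw [h2]
  field_simp
  ring


theorem proposition5p4 (c : ℝ) :
    ∃ K : ℝ, ∀ (D m : ℕ), 3 ∣ m → 0 < m →
      ∀ A A' : Matrix (Fin D) (Fin D) ℝ, A.PosSemidef →
        ∀ (Ω : Type*) [MeasurableSpace Ω] (P : Measure Ω) [IsProbabilityMeasure P]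
          (S G : Ω → Matrix (Fin D) (Fin (m / 3)) ℝ), IsGaussianSketchAndProbes P S G →
          ∀ (r : Ω → ℕ) (Q : (ω : Ω) → Matrix (Fin D) (Fin (r ω)) ℝ),
            (∀ ω, IsQRBasis (A * S ω) (Q ω)) →
            MemLp (fun ω => approxHutchPP A' (Q ω) (G ω)) 2 P ∧
            ∫ ω, approxHutchPP A' (Q ω) (G ω) ∂P = A'.trace ∧
            (3 < m → ∀ (Ls : ℕ) (η : ℝ), 1 ≤ Ls → 0 < η →
              ‖A' - A‖ ≤ c * (((Ls : ℝ) - 1) * η) →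
              variance (fun ω => approxHutchPP A' (Q ω) (G ω)) P ≤
                36 / ((m : ℝ) * ((m : ℝ) - 3)) * A.trace ^ 2
                  + 1 / (m : ℝ) * (K * (((Ls : ℝ) - 1) ^ 2 * η ^ 2))) := by
  refine ⟨12 * c ^ 2, fun D m hdvd hm A A' hA Ω _ P _ S G hSG r Q hQ => ?_⟩
  obtain ⟨n, rfl⟩ := hdvd
  generalize hk : 3 * n / 3 = k at S G hSG hQ
  obtain rfl : k = n := by omega
  obtain ⟨h1, h2, h3⟩ := hutchPP_moments A' hA (by omega) A'.trace hSG.hasLaw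
  have hZ := funext fun ω => (hQ ω).approxHutchPP_eq_add_error A' (G ω)
  rw [hZ]
  refine ⟨h1, h2, fun hm3 Ls η _ _ hpert => ?_⟩
  have hk2 : 2 ≤ k := by omega
  refine (h3 hk2).trans ?_
  have hE : (A' - A).entrySq ≤ c ^ 2 * (((Ls : ℝ) - 1) ^ 2 * η ^ 2) := by
    -- Squaring needs no sign condition on `c`: the bound dominates a norm, hence is nonnegative.
    rw [Matrix.entrySq_eq_norm_sq, ← mul_pow, ← mul_pow]
    exact pow_le_pow_left₀ (norm_nonneg _) hpert 2
  rw [variance_bound_eq hk2]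
  exact add_le_add_right (mul_le_mul_of_nonneg_left hE (by positivity)) _
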